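/- Let $n\in\mathbb{N}$, let $\mathcal{M}_n$ be the space of complex $n\times n$ matrices, write $A\ge B$ (resp. $A>0$) if $A-B$ is positive semidefinite (resp. $A$ is positive definite), and let $\mathcal{E}:\mathcal{M}_n\to\mathcal{M}_n$ be a linear map that is positive ($A\ge 0$ implies $\mathcal{E}(A)\ge 0$) and trace-preserving. Suppose there is an $\varepsilon>0$ with $n\varepsilon\le 1$ such that every matrix $\rho\ge\varepsilon\mathbf{1}$ with $\operatorname{tr}\rho=1$ satisfies $$\mathcal{E}(\rho)\;\ge\;\frac{n\varepsilon}{1+(n-1)n\varepsilon}\,\mathbf{1}.$$ Then there are matrices $X,Y>0$ in $\mathcal{M}_n$ such that the map $\mathcal{E}'(A):=Y^{-1}\mathcal{E}(XAX^{\dagger})(Y^{-1})^{\dagger}$ is doubly stochastic, i.e. $\mathcal{E}'$ is positive and $\mathcal{E}'(\mathbf{1})=\mathcal{E}'^{*}(\mathbf{1})=\mathbf{1}$, where $\mathcal{E}'^{*}$ is the adjoint of $\mathcal{E}'$ with respect to the Hilbert–Schmidt inner product $\langle A,B\rangle=\operatorname{tr}(A^{\dagger}B)$. -/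

import Mathlib

open scoped ComplexOrder MatrixOrder

namespace OperatorScaling

/-- The complex `n × n` matrices. With `MatrixOrder` open, `A ≤ B` is the Loewner order,
that is, `B - A` is positive semidefinite. -/
abbrev Mat (n : ℕ) : Type := Matrix (Fin n) (Fin n) ℂ

/-- A linear map of matrices is positive if it sends positive semidefinite matrices
to positive semidefinite matrices. -/
def IsPositiveMap {n : ℕ} (E : Mat n →ₗ[ℂ] Mat n) : Prop :=
  ∀ A : Mat n, A.PosSemidef → (E A).PosSemidef

/-- `tr (E A) = tr A` for every matrix `A`. -/
def IsTracePreserving {n : ℕ} (E : Mat n →ₗ[ℂ] Mat n) : Prop :=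
  ∀ A : Mat n, (E A).trace = A.trace

/-- The adjoint `E*` of `E` for the Hilbert–Schmidt inner product `⟨A, B⟩ = tr (Aᴴ B)`.
Its `(i, j)` entry at `A` is `⟨e i j, E* A⟩ = ⟨E (e i j), A⟩`, with `e i j` the matrix unit;
`trace_conjTranspose_mul_hsAdjoint` is the defining property. -/
def hsAdjoint {n : ℕ} (E : Mat n →ₗ[ℂ] Mat n) : Mat n →ₗ[ℂ] Mat n where
  toFun A := Matrix.of fun i j => ((E (Matrix.single i j 1)).conjTranspose * A).trace
  map_add' A B := by
    ext i j
    simp [Matrix.mul_add, Matrix.trace_add]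
  map_smul' c A := by
    ext i j
    simp [Matrix.trace_smul]

/-- The defining property of the adjoint: `⟨B, E* A⟩ = ⟨E B, A⟩`. -/
theorem trace_conjTranspose_mul_hsAdjoint {n : ℕ} (E : Mat n →ₗ[ℂ] Mat n) (A B : Mat n) :
    (B.conjTranspose * hsAdjoint E A).trace = ((E B).conjTranspose * A).trace := by
  have hB : E B = ∑ i, ∑ j, B i j • E (Matrix.single i j 1) := by
    conv_lhs => rw [Matrix.matrix_eq_sum_single B]
    simp only [map_sum]
    refine Finset.sum_congr rfl fun i _ => Finset.sum_congr rfl fun j _ => ?_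
    rw [← map_smul, Matrix.smul_single, smul_eq_mul, mul_one]
  rw [hB]
  simp only [Matrix.conjTranspose_sum, Matrix.conjTranspose_smul, Finset.sum_mul,
    Matrix.smul_mul, Matrix.trace_sum, Matrix.trace_smul]
  rw [Finset.sum_comm]
  simp [Matrix.trace, Matrix.mul_apply, hsAdjoint]

/-- A doubly stochastic map: a positive map with `E 1 = E* 1 = 1`. -/
structure IsDoublyStochastic {n : ℕ} (E : Mat n →ₗ[ℂ] Mat n) : Prop where
  positive : IsPositiveMap E
  map_one : E 1 = 1
  adjoint_map_one : hsAdjoint E 1 = 1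

/-- The scaled map `A ↦ Y⁻¹ E(X A Xᴴ) (Y⁻¹)ᴴ`. -/
noncomputable def scaling {n : ℕ} (E : Mat n →ₗ[ℂ] Mat n) (X Y : Mat n) :
    Mat n →ₗ[ℂ] Mat n where
  toFun A := Y⁻¹ * E (X * A * X.conjTranspose) * Y⁻¹.conjTranspose
  map_add' A B := by simp [Matrix.mul_add, Matrix.add_mul]
  map_smul' c A := by simp

end OperatorScaling

namespace OperatorScaling

open Matrix

/-! The scaling comes from minimising `det (E X) / det X` over `X > 0`. At a minimiser the first
variation vanishes: `tr ((E X)⁻¹ E B) = tr (X⁻¹ B)` for all `B`, that is `E* ((E X)⁻¹) = X⁻¹`.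
Conjugating by the square roots of `X` and `E X` turns this into `E'* 1 = 1`, while `E' 1 = 1` holds
by the choice of roots.

The hypothesis is needed for the minimum to exist. Write `δ` for the lower bound on `E ρ`. If `n >
1` and `n ε < 1`, then `δ > ε`, and `eigenvalue_gap` bounds each eigenvalue of `E X` after the
largest below by `δ - ε` times the preceding eigenvalue of `X`. When `tr X = 1`, the largest
eigenvalue of `E X` is at least `1 / n`, so the ratio is at least a positive constant over the
smallest eigenvalue of `X`. It blows up at the boundary, and compactness applies. If `n ≤ 1` or `n ε
= 1`, then `E 1 = 1` already. -/

/-- The matrix `U D Uᴴ`, with `D` the real diagonal matrix with diagonal `d`. -/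
noncomputable def conjDiag {n : ℕ} (U : Mat n) (d : Fin n → ℝ) : Mat n :=
  U * diagonal (fun i => (d i : ℂ)) * Uᴴ

/-! ### Spectral calculus and trace inequalities. -/

section conjDiag

variable {n : ℕ} {U : Mat n}

theorem conjDiag_posSemidef (U : Mat n) {d : Fin n → ℝ} (hd : ∀ i, 0 ≤ d i) :
    (conjDiag U d).PosSemidef := by
  refine (PosSemidef.diagonal ?_).mul_mul_conjTranspose_same U
  intro i
  simpa using hd i

theorem conjDiag_add (U : Mat n) (d e : Fin n → ℝ) :
    conjDiag U (d + e) = conjDiag U d + conjDiag U e := by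
  simp [conjDiag, ← Matrix.add_mul, ← Matrix.mul_add, diagonal_add]

theorem conjDiag_sub (U : Mat n) (d e : Fin n → ℝ) :
    conjDiag U (d - e) = conjDiag U d - conjDiag U e := by
  simp [conjDiag, ← Matrix.sub_mul, ← Matrix.mul_sub, diagonal_sub]

theorem conjDiag_smul (U : Mat n) (c : ℝ) (d : Fin n → ℝ) :
    conjDiag U (c • d) = c • conjDiag U d := by
  have : (diagonal (fun i => ((c • d) i : ℂ)) : Mat n) = c • diagonal (fun i => (d i : ℂ)) := by
    rw [← diagonal_smul]; congr 1; ext i; simp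
  rw [conjDiag, this]
  simp [conjDiag]

theorem conjDiag_one (hU : U ∈ unitaryGroup (Fin n) ℂ) : conjDiag U 1 = 1 := by
  have h := mem_unitaryGroup_iff.1 hU
  rw [star_eq_conjTranspose] at h
  simp [conjDiag, h]

theorem conjDiag_mul (hU : U ∈ unitaryGroup (Fin n) ℂ) (d e : Fin n → ℝ) :
    conjDiag U d * conjDiag U e = conjDiag U (d * e) := by
  have h := mem_unitaryGroup_iff'.1 hU
  rw [star_eq_conjTranspose] at h
  calc conjDiag U d * conjDiag U e
      = U * diagonal (fun i => (d i : ℂ)) * (Uᴴ * U) * diagonal (fun i => (e i : ℂ)) * Uᴴ := by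
        simp only [conjDiag, Matrix.mul_assoc]
    _ = _ := by simp [h, conjDiag, Matrix.mul_assoc, ← diagonal_mul_diagonal]

theorem trace_conjDiag (hU : U ∈ unitaryGroup (Fin n) ℂ) (d : Fin n → ℝ) :
    (conjDiag U d).trace = ((∑ i, d i : ℝ) : ℂ) := by
  have h := mem_unitaryGroup_iff'.1 hU
  rw [star_eq_conjTranspose] at h
  rw [conjDiag, trace_mul_comm, ← Matrix.mul_assoc, h]
  simp [trace_diagonal]

theorem det_conjDiag (hU : U ∈ unitaryGroup (Fin n) ℂ) (d : Fin n → ℝ) :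
    (conjDiag U d).det = ((∏ i, d i : ℝ) : ℂ) := by
  have h := mem_unitaryGroup_iff'.1 hU
  rw [star_eq_conjTranspose] at h
  rw [conjDiag, det_mul_comm, ← Matrix.mul_assoc, h]
  simp

theorem conjDiag_posDef (hU : U ∈ unitaryGroup (Fin n) ℂ) {d : Fin n → ℝ} (hd : ∀ i, 0 < d i) :
    (conjDiag U d).PosDef := by
  rw [(conjDiag_posSemidef U fun i => (hd i).le).posDef_iff_det_ne_zero, det_conjDiag hU]
  exact_mod_cast (Finset.prod_pos fun i _ => hd i).ne'

/-- Spectral theorem, with the eigenvalues in decreasing order. -/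
theorem exists_conjDiag_antitone {A : Mat n} (hA : A.IsHermitian) :
    ∃ U ∈ unitaryGroup (Fin n) ℂ, ∃ d : Fin n → ℝ, Antitone d ∧ A = conjDiag U d := by
  set σ := Tuple.sort (-hA.eigenvalues)
  have hσ := Tuple.monotone_sort (-hA.eigenvalues)
  set V : Mat n := (hA.eigenvectorUnitary : Mat n)
  have hV : Vᴴ * V = 1 := by
    have := mem_unitaryGroup_iff'.1 hA.eigenvectorUnitary.2
    rwa [star_eq_conjTranspose] at this
  refine ⟨V.submatrix id σ, ?_, hA.eigenvalues ∘ σ, ?_, ?_⟩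
  · rw [mem_unitaryGroup_iff', star_eq_conjTranspose, conjTranspose_submatrix,
      ← submatrix_mul _ _ _ _ _ Function.bijective_id, hV, submatrix_one_equiv]
  · intro i j hij
    have := hσ hij
    simpa using this
  · have h := hA.spectral_theorem
    rw [Unitary.conjStarAlgAut_apply] at h
    have e : (diagonal (fun i => ((hA.eigenvalues ∘ σ) i : ℂ)) : Mat n)
        = (diagonal (fun i => (hA.eigenvalues i : ℂ))).submatrix σ σ := by
      rw [submatrix_diagonal_equiv]; rfl
    rw [conjDiag, e, conjTranspose_submatrix, submatrix_mul_equiv, submatrix_mul_equiv,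
      submatrix_id_id]
    exact h

theorem conjDiag_posSemidef_iff (hU : U ∈ unitaryGroup (Fin n) ℂ) {d : Fin n → ℝ} :
    (conjDiag U d).PosSemidef ↔ ∀ i, 0 ≤ d i := by
  refine ⟨fun h i => ?_, conjDiag_posSemidef U⟩
  have h1 := h.conjTranspose_mul_mul_same U
  have hUU := mem_unitaryGroup_iff'.1 hU
  rw [star_eq_conjTranspose] at hUU
  have h2 : Uᴴ * conjDiag U d * U = diagonal (fun i => (d i : ℂ)) := by
    calc _ = (Uᴴ * U) * diagonal (fun i => (d i : ℂ)) * (Uᴴ * U) := by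
          simp only [conjDiag, Matrix.mul_assoc]
      _ = _ := by simp [hUU]
  rw [h2] at h1
  simpa using h1.diag_nonneg (i := i)

/-- In an eigenbasis of `A` the trace is a sum of eigenvalues of `A` times diagonal entries of a
conjugate of `B`. -/
theorem trace_mul_re_nonneg {A B : Mat n} (hA : A.PosSemidef) (hB : B.PosSemidef) :
    0 ≤ (A * B).trace.re := by
  obtain ⟨U, hU, d, -, rfl⟩ := exists_conjDiag_antitone hA.isHermitian
  have hd := (conjDiag_posSemidef_iff hU).1 hA
  have h3 : (conjDiag U d * B).trace = (diagonal (fun i => (d i : ℂ)) * (Uᴴ * B * U)).trace := by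
    rw [conjDiag, Matrix.mul_assoc, Matrix.mul_assoc, trace_mul_comm]
    simp only [Matrix.mul_assoc]
  rw [h3, Matrix.trace, Complex.re_sum]
  refine Finset.sum_nonneg fun i _ => ?_
  have h4 := (Complex.le_def.1 ((hB.conjTranspose_mul_mul_same U).diag_nonneg (i := i))).1
  rw [diag_apply, diagonal_mul, Complex.re_ofReal_mul]
  exact mul_nonneg (hd i) h4

theorem trace_mul_re_le {A B C : Mat n} (hA : A.PosSemidef) (h : (C - B).PosSemidef) :
    (A * B).trace.re ≤ (A * C).trace.re := by
  have := trace_mul_re_nonneg hA h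
  rw [Matrix.mul_sub, trace_sub, Complex.sub_re] at this
  linarith

theorem conjDiag_pos_of_posDef (hU : U ∈ unitaryGroup (Fin n) ℂ) {d : Fin n → ℝ}
    (h : (conjDiag U d).PosDef) (i : Fin n) : 0 < d i := by
  refine lt_of_le_of_ne ((conjDiag_posSemidef_iff hU).1 h.posSemidef i) fun h0 => ?_
  have := h.det_pos.ne'
  rw [det_conjDiag hU, Finset.prod_eq_zero (Finset.mem_univ i) h0.symm] at this
  simp at this

theorem exists_posDef_sq {A : Mat n} (hA : A.PosDef) : ∃ B : Mat n, B.PosDef ∧ B * B = A := by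
  obtain ⟨U, hU, d, -, rfl⟩ := exists_conjDiag_antitone hA.isHermitian
  have hd := conjDiag_pos_of_posDef hU hA
  refine ⟨conjDiag U fun i => √(d i), conjDiag_posDef hU fun i => Real.sqrt_pos.2 (hd i), ?_⟩
  rw [conjDiag_mul hU]
  congr 1
  ext i
  exact Real.mul_self_sqrt (hd i).le

end conjDiag

/-! ### Eigenvalue gap and blow-up of the determinant ratio. -/

variable {n : ℕ} {E : Mat n →ₗ[ℂ] Mat n}

theorem IsPositiveMap.sub_posSemidef (hpos : IsPositiveMap E) {A B : Mat n}
    (h : (A - B).PosSemidef) : (E A - E B).PosSemidef := by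
  rw [← map_sub]; exact hpos _ h

theorem map_real_smul (E : Mat n →ₗ[ℂ] Mat n) (c : ℝ) (A : Mat n) : E (c • A) = c • E A := by
  rw [← Complex.coe_smul, map_smul, Complex.coe_smul]

/-- The `(r + 1)`-st largest eigenvalue of `E X` controls the `r`-th largest eigenvalue of `X`,
if `E` maps states bounded below by `ε` to matrices bounded below by `δ`. -/
theorem eigenvalue_gap (hpos : IsPositiveMap E) (htr : IsTracePreserving E) {ε δ : ℝ}
    (hε : 0 < ε) (hnε : (n : ℝ) * ε ≤ 1)
    (hE : ∀ ρ : Mat n, ε • (1 : Mat n) ≤ ρ → ρ.trace = 1 → δ • (1 : Mat n) ≤ E ρ)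
    {U V : Mat n} (hU : U ∈ unitaryGroup (Fin n) ℂ) (hV : V ∈ unitaryGroup (Fin n) ℂ)
    {l m : Fin n → ℝ} (hl : Antitone l) (hm : Antitone m) (hl0 : ∀ i, 0 ≤ l i)
    (h : E (conjDiag U l) = conjDiag V m) {i j : Fin n} (hij : (i : ℕ) = j + 1) :
    (δ - ε) * l j ≤ m i := by
  -- `p` selects the top `r` eigenvectors of `X`, `q` the bottom `n - r` of `E X`; the proof
  -- estimates `tr (Q E X)` from both sides.
  set p : Fin n → ℝ := fun k => if k ≤ j then 1 else 0 with hp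
  set q : Fin n → ℝ := fun k => if i ≤ k then 1 else 0 with hq
  have hp0 : ∀ k, 0 ≤ p k := fun k => by simp only [hp]; split_ifs <;> norm_num
  have hp1 : ∀ k, 0 ≤ (1 - p) k := fun k => by
    simp only [hp, Pi.sub_apply, Pi.one_apply]; split_ifs <;> norm_num
  have hq0 : ∀ k, 0 ≤ q k := fun k => by simp only [hq]; split_ifs <;> norm_num
  have hq1 : ∀ k, 0 ≤ (1 - q) k := fun k => by
    simp only [hq, Pi.sub_apply, Pi.one_apply]; split_ifs <;> norm_num
  have hpq : q = 1 - p := by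
    ext k
    simp only [hq, hp, Pi.sub_apply, Pi.one_apply]
    have : i ≤ k ↔ ¬ k ≤ j := by rw [not_le, Fin.le_def, Fin.lt_def]; omega
    by_cases hk : k ≤ j <;> simp [this, hk, -not_le]
  set r : ℝ := ∑ k, p k with hr
  have hr1 : 1 ≤ r := by
    have := Finset.single_le_sum (fun k _ => hp0 k) (Finset.mem_univ j)
    have h1 : p j = 1 := by simp [hp]
    linarith
  have hs : ∑ k, q k = n - r := by
    rw [hpq]; simp [Finset.sum_sub_distrib, hr]
  have hnr : 0 < n - r := by
    rw [← hs]
    have := Finset.single_le_sum (fun k _ => hq0 k) (Finset.mem_univ i)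
    have h1 : q i = 1 := by simp [hq]
    linarith
  have hQ := conjDiag_posSemidef V hq0
  have hQtr := trace_conjDiag hV q
  set Q := conjDiag V q
  set A := conjDiag U p
  set B := conjDiag U (1 - p)
  have hAB : A + B = 1 := by rw [← conjDiag_add, add_sub_cancel, conjDiag_one hU]
  -- The weight that gives `a A + ε B` trace 1; `n ε ≤ 1` yields `ε ≤ a`, and `r ≥ 1` yields `a ≤
  -- 1`.
  set a : ℝ := (1 - (n - r) * ε) / r with ha
  have har : a * r = 1 - (n - r) * ε := div_mul_cancel₀ _ (by linarith)
  have haε : ε ≤ a := by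
    rw [ha, le_div_iff₀ (by linarith)]; nlinarith
  have ha1 : a ≤ 1 := by
    rw [ha, div_le_one (by linarith)]; nlinarith
  have hρ : δ • (1 : Mat n) ≤ E (a • A + ε • B) := by
    apply hE
    · rw [le_iff, ← hAB]
      have : a • A + ε • B - ε • (A + B) = (a - ε) • A := by module
      rw [this]
      rw [← conjDiag_smul]
      exact conjDiag_posSemidef U fun k => mul_nonneg (by linarith) (hp0 k)
    · rw [trace_add, trace_smul, trace_smul, trace_conjDiag hU, trace_conjDiag hU, ← hpq, hs, ← hr]
      simp only [Complex.real_smul]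
      rw [← Complex.ofReal_mul, ← Complex.ofReal_mul, ← Complex.ofReal_add, har]
      norm_num
      ring
  have h1 := trace_mul_re_le hQ (le_iff.1 hρ)
  -- `Q ≤ 1`, so the trace is at most `tr (E B) = tr B`.
  have h2 : (Q * E B).trace.re ≤ n - r := by
    have h3 := trace_mul_re_nonneg (conjDiag_posSemidef V hq1)
      (hpos _ (conjDiag_posSemidef U hp1))
    rw [conjDiag_sub, conjDiag_one hV, Matrix.sub_mul, Matrix.one_mul, trace_sub, htr,
      trace_conjDiag hU, ← hpq, hs, Complex.sub_re, Complex.ofReal_re] at h3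
    rw [hpq] at h3
    simp only [Q, B, hpq] at h3 ⊢
    linarith
  have h4 : 0 ≤ (Q * E A).trace.re := trace_mul_re_nonneg hQ (hpos _ (conjDiag_posSemidef U hp0))
  have h5 : (δ - ε) * (n - r) ≤ (Q * E A).trace.re := by
    rw [map_add, map_real_smul, map_real_smul, Matrix.mul_smul, Matrix.mul_one, trace_smul,
      Matrix.mul_add, Matrix.mul_smul, Matrix.mul_smul, trace_add, trace_smul, trace_smul, hQtr,
      hs, Complex.add_re, Complex.smul_re, Complex.smul_re, Complex.smul_re, Complex.ofReal_re,
      smul_eq_mul, smul_eq_mul, smul_eq_mul] at h1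
    nlinarith
  have h6 : l j * (Q * E A).trace.re ≤ (Q * E (conjDiag U l)).trace.re := by
    have h7 : (conjDiag U l - l j • A).PosSemidef := by
      rw [← conjDiag_smul, ← conjDiag_sub]
      refine conjDiag_posSemidef U fun k => ?_
      by_cases hk : k ≤ j
      · simpa [hp, hk] using hl hk
      · simpa [hp, hk] using hl0 k
    have h8 := trace_mul_re_le hQ (hpos.sub_posSemidef h7)
    rwa [map_real_smul, Matrix.mul_smul, trace_smul, Complex.smul_re, smul_eq_mul] at h8
  have h9 : (Q * E (conjDiag U l)).trace.re ≤ (n - r) * m i := by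
    rw [h, conjDiag_mul hV, trace_conjDiag hV, Complex.ofReal_re, ← hs, Finset.sum_mul]
    refine Finset.sum_le_sum fun k _ => ?_
    by_cases hk : i ≤ k
    · simpa [hq, hk] using hm hk
    · simp [hq, hk]
  have h10 := mul_le_mul_of_nonneg_left h5 (hl0 j)
  refine le_of_mul_le_mul_left ?_ hnr
  linarith

/-- A lower bound for `det (E X) / det X` that blows up at singular states `X`. -/
theorem prod_eigenvalues_bound {k : ℕ} {E : Mat (k + 1) →ₗ[ℂ] Mat (k + 1)}
    (hpos : IsPositiveMap E) (htr : IsTracePreserving E) {ε δ : ℝ}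
    (hε : 0 < ε) (hnε : ((k + 1 : ℕ) : ℝ) * ε ≤ 1) (hεδ : ε < δ)
    (hE : ∀ ρ : Mat (k + 1), ε • (1 : Mat (k + 1)) ≤ ρ → ρ.trace = 1 →
      δ • (1 : Mat (k + 1)) ≤ E ρ)
    {U V : Mat (k + 1)} (hU : U ∈ unitaryGroup (Fin (k + 1)) ℂ)
    (hV : V ∈ unitaryGroup (Fin (k + 1)) ℂ)
    {l m : Fin (k + 1) → ℝ} (hl : Antitone l) (hm : Antitone m) (hl0 : ∀ i, 0 < l i)
    (hsum : ∑ i, l i = 1) (h : E (conjDiag U l) = conjDiag V m) :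
    (∀ i, 0 < m i) ∧
      (δ - ε) ^ k / (k + 1) * ∏ i, l i ≤ (∏ i, m i) * l (Fin.last k) := by
  have hm0 : 1 / ((k : ℝ) + 1) ≤ m 0 := by
    have h1 : ∑ i, m i = 1 := by
      have := htr (conjDiag U l)
      rw [h, trace_conjDiag hU, trace_conjDiag hV, hsum] at this
      exact_mod_cast this
    have h2 : ∑ i, m i ≤ ∑ _i : Fin (k + 1), m 0 :=
      Finset.sum_le_sum fun i _ => hm (Fin.zero_le i)
    rw [h1] at h2
    simp at h2
    rw [div_le_iff₀ (by positivity)]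
    linarith
  have hgap : ∀ i : Fin k, (δ - ε) * l i.castSucc ≤ m i.succ := fun i =>
    eigenvalue_gap hpos htr hε hnε hE hU hV hl hm (fun i => (hl0 i).le) h (by simp)
  have hδε : 0 < δ - ε := by linarith
  have hpos0 : (0 : ℝ) < 1 / ((k : ℝ) + 1) := by positivity
  refine ⟨fun i => ?_, ?_⟩
  · induction i using Fin.cases with
    | zero => linarith
    | succ i => exact lt_of_lt_of_le (mul_pos hδε (hl0 _)) (hgap i)
  · rw [Fin.prod_univ_succ m, Fin.prod_univ_castSucc l, ← mul_assoc]
    refine mul_le_mul_of_nonneg_right ?_ (hl0 _).le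
    have h3 : ∏ i : Fin k, (δ - ε) * l i.castSucc ≤ ∏ i : Fin k, m i.succ :=
      Finset.prod_le_prod (fun i _ => (mul_pos hδε (hl0 _)).le) fun i _ => hgap i
    rw [Finset.prod_mul_distrib, Finset.prod_const, Finset.card_univ, Fintype.card_fin] at h3
    have h4 : 0 ≤ (δ - ε) ^ k * ∏ i : Fin k, l i.castSucc :=
      mul_nonneg (by positivity) (Finset.prod_nonneg fun i _ => (hl0 _).le)
    calc _ = 1 / ((k : ℝ) + 1) * ((δ - ε) ^ k * ∏ i : Fin k, l i.castSucc) := by ring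
      _ ≤ _ := mul_le_mul hm0 h3 h4 (by linarith)

theorem det_bound_of_conjDiag {k : ℕ} {E : Mat (k + 1) →ₗ[ℂ] Mat (k + 1)}
    (hpos : IsPositiveMap E) (htr : IsTracePreserving E) {ε δ : ℝ}
    (hε : 0 < ε) (hnε : ((k + 1 : ℕ) : ℝ) * ε ≤ 1) (hεδ : ε < δ)
    (hE : ∀ ρ : Mat (k + 1), ε • (1 : Mat (k + 1)) ≤ ρ → ρ.trace = 1 →
      δ • (1 : Mat (k + 1)) ≤ E ρ)
    {U : Mat (k + 1)} (hU : U ∈ unitaryGroup (Fin (k + 1)) ℂ)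
    {l : Fin (k + 1) → ℝ} (hl : Antitone l) (hl0 : ∀ i, 0 < l i) (hsum : ∑ i, l i = 1) :
    (E (conjDiag U l)).PosDef ∧
      (δ - ε) ^ k / (k + 1) * ∏ i, l i ≤ (E (conjDiag U l)).det.re * l (Fin.last k) := by
  obtain ⟨V, hV, m, hm, h⟩ := exists_conjDiag_antitone
    (hpos _ (conjDiag_posSemidef U fun i => (hl0 i).le)).isHermitian
  obtain ⟨hm0, hb⟩ := prod_eigenvalues_bound hpos htr hε hnε hεδ hE hU hV hl hm hl0 hsum h
  rw [h, det_conjDiag hV, Complex.ofReal_re]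
  exact ⟨conjDiag_posDef hV hm0, hb⟩

/-! ### Existence of a minimiser. -/

/-- Spectral data of the states whose eigenvalues are at least `c`. -/
def spectralData (n : ℕ) (c : ℝ) : Set (Mat n × (Fin n → ℝ)) :=
  {w | w.1 ∈ unitaryGroup (Fin n) ℂ ∧ Antitone w.2 ∧ ∑ i, w.2 i = 1 ∧ ∀ i, c ≤ w.2 i}

/-- Keeping eigenbasis and eigenvalues as separate coordinates avoids any appeal to continuity of
eigenvalues. -/
theorem isCompact_spectralData (n : ℕ) {c : ℝ} (hc : 0 ≤ c) : IsCompact (spectralData n c) := by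
  have hK : IsCompact ((Set.univ.pi fun _ : Fin n => Set.univ.pi fun _ : Fin n =>
      Metric.closedBall (0 : ℂ) 1) ×ˢ (Set.univ.pi fun _ : Fin n => Set.Icc (0 : ℝ) 1)) :=
    (isCompact_univ_pi fun _ => isCompact_univ_pi fun _ => isCompact_closedBall _ _).prod
      (isCompact_univ_pi fun _ => isCompact_Icc)
  refine IsCompact.of_isClosed_subset hK ?_ ?_
  · have h1 : IsClosed {w : Mat n × (Fin n → ℝ) | star w.1 * w.1 = 1} := by
      simp only [star_eq_conjTranspose]
      exact isClosed_eq (by fun_prop) continuous_const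
    have h2 : IsClosed {w : Mat n × (Fin n → ℝ) | ∀ i j, i ≤ j → w.2 j ≤ w.2 i} := by
      simp only [Set.ofPred_forall]
      exact isClosed_iInter fun i => isClosed_iInter fun j => isClosed_iInter fun _ =>
        isClosed_le (by fun_prop) (by fun_prop)
    have h3 : IsClosed {w : Mat n × (Fin n → ℝ) | ∑ i, w.2 i = 1} :=
      isClosed_eq (by fun_prop) continuous_const
    have h4 : IsClosed {w : Mat n × (Fin n → ℝ) | ∀ i, c ≤ w.2 i} := by
      simp only [Set.ofPred_forall]
      exact isClosed_iInter fun i => isClosed_le continuous_const (by fun_prop)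
    convert h1.inter (h2.inter (h3.inter h4)) using 1
    ext w
    simp only [spectralData, mem_unitaryGroup_iff', Set.mem_ofPred_eq, Set.mem_inter_iff]
    rfl
  · rintro ⟨U, l⟩ ⟨hU, -, hsum, hl⟩
    refine ⟨fun i _ j _ => by simpa using entry_norm_bound_of_unitary hU i j, fun i _ => ?_⟩
    refine ⟨hc.trans (hl i), ?_⟩
    rw [← hsum]
    exact Finset.single_le_sum (fun j _ => hc.trans (hl j)) (Finset.mem_univ i)

theorem continuous_conjDiag (n : ℕ) :
    Continuous fun w : Mat n × (Fin n → ℝ) => conjDiag w.1 w.2 := by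
  unfold conjDiag
  fun_prop

/-- The ratio `det (E X) / det X` attains its minimum over the positive definite matrices. -/
theorem exists_det_ratio_minimizer {k : ℕ} {E : Mat (k + 1) →ₗ[ℂ] Mat (k + 1)}
    (hpos : IsPositiveMap E) (htr : IsTracePreserving E) {ε δ : ℝ}
    (hε : 0 < ε) (hnε : ((k + 1 : ℕ) : ℝ) * ε ≤ 1) (hεδ : ε < δ)
    (hE : ∀ ρ : Mat (k + 1), ε • (1 : Mat (k + 1)) ≤ ρ → ρ.trace = 1 →
      δ • (1 : Mat (k + 1)) ≤ E ρ) :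
    ∃ X₀ : Mat (k + 1), X₀.PosDef ∧ (E X₀).PosDef ∧ ∀ X : Mat (k + 1), X.PosDef →
      (E X₀).det.re * X.det.re ≤ (E X).det.re * X₀.det.re := by
  have hb := fun {U} hU {l} hl hl0 hsum =>
    det_bound_of_conjDiag (U := U) (l := l) hpos htr hε hnε hεδ hE hU hl hl0 hsum
  set C : ℝ := (δ - ε) ^ k / (k + 1) with hC
  have hC0 : 0 < C := by
    have : 0 < δ - ε := by linarith
    positivity
  set f : Mat (k + 1) × (Fin (k + 1) → ℝ) → ℝ :=
    fun w => (E (conjDiag w.1 w.2)).det.re / ∏ i, w.2 i with hf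
  set l₁ : Fin (k + 1) → ℝ := fun _ => 1 / ((k : ℝ) + 1) with hl₁
  have hl₁0 : ∀ i, 0 < l₁ i := fun i => by simp only [hl₁]; positivity
  have hl₁s : ∑ i, l₁ i = 1 := by simp [hl₁]; field_simp
  have hl₁a : Antitone l₁ := fun _ _ _ => le_rfl
  set M := f (1, l₁) with hM
  have hM0 : 0 ≤ M := by
    have := (hb (one_mem _) hl₁a hl₁0 hl₁s).1.det_pos
    exact div_nonneg (Complex.le_def.1 this.le).1 (Finset.prod_nonneg fun i _ => (hl₁0 i).le)
  -- If the smallest eigenvalue is below `C / (M + 1)`, the ratio exceeds its value `M` at the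
  -- maximally mixed state; the other bound keeps that state in the compact set.
  set c := min (1 / ((k : ℝ) + 1)) (C / (M + 1)) with hc
  have hc0 : 0 < c := lt_min (by positivity) (by positivity)
  have hmem : ((1 : Mat (k + 1)), l₁) ∈ spectralData (k + 1) c :=
    ⟨one_mem _, hl₁a, hl₁s, fun i => min_le_left _ _⟩
  have hcont : ContinuousOn f (spectralData (k + 1) c) := by
    refine ContinuousOn.div ?_ ?_ ?_
    · have h1 : Continuous E := E.continuous_of_finiteDimensional
      have h2 := (h1.comp (continuous_conjDiag (k + 1))).matrix_det
      exact (Complex.continuous_re.comp h2).continuousOn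
    · exact Continuous.continuousOn (by fun_prop)
    · rintro w ⟨-, -, -, hw⟩
      exact (Finset.prod_pos fun i _ => hc0.trans_le (hw i)).ne'
  obtain ⟨⟨U₀, l₀⟩, ⟨hU₀, hl₀a, hl₀s, hl₀c⟩, hmin⟩ :=
    (isCompact_spectralData (k + 1) hc0.le).exists_isMinOn ⟨_, hmem⟩ hcont
  have hl₀0 : ∀ i, 0 < l₀ i := fun i => hc0.trans_le (hl₀c i)
  have hall : ∀ {U : Mat (k + 1)}, U ∈ unitaryGroup (Fin (k + 1)) ℂ →
      ∀ {l : Fin (k + 1) → ℝ}, Antitone l → (∀ i, 0 < l i) → ∑ i, l i = 1 →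
      f (U₀, l₀) ≤ f (U, l) := by
    intro U hU l hla hl0 hls
    by_cases hlast : c ≤ l (Fin.last k)
    · exact hmin (a := (U, l)) ⟨hU, hla, hls, fun i => hlast.trans (hla (Fin.le_last i))⟩
    · refine (hmin hmem).trans ?_
      have hp : 0 < ∏ i, l i := Finset.prod_pos fun i _ => hl0 i
      obtain ⟨h1, h2⟩ := hb hU hla hl0 hls
      have h3 : 0 ≤ (E (conjDiag U l)).det.re := (Complex.le_def.1 h1.det_pos.le).1
      have h4 : l (Fin.last k) ≤ C / (M + 1) := (not_le.1 hlast).le.trans (min_le_right _ _)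
      have h5 := h2.trans (mul_le_mul_of_nonneg_left h4 h3)
      change M ≤ _ / _
      rw [le_div_iff₀ hp]
      rw [mul_div_assoc', le_div_iff₀ (by linarith)] at h5
      have h6 : C * ((∏ i, l i) * (M + 1)) ≤ C * (E (conjDiag U l)).det.re := by linarith
      have h7 := le_of_mul_le_mul_left h6 hC0
      linarith
  refine ⟨conjDiag U₀ l₀, conjDiag_posDef hU₀ hl₀0, (hb hU₀ hl₀a hl₀0 hl₀s).1, fun X hX => ?_⟩
  obtain ⟨U, hU, l, hla, rfl⟩ := exists_conjDiag_antitone hX.isHermitian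
  have hl0 := conjDiag_pos_of_posDef hU hX
  set t : ℝ := ∑ i, l i with ht
  have ht0 : 0 < t := Finset.sum_pos (fun i _ => hl0 i) Finset.univ_nonempty
  -- The ratio is homogeneous of degree 0, so `X` may be normalised to trace 1.
  have h1 := hall hU (l := t⁻¹ • l) (fun i j hij => by
      simpa using mul_le_mul_of_nonneg_left (hla hij) (inv_pos.2 ht0).le)
    (fun i => mul_pos (inv_pos.2 ht0) (hl0 i))
    (by simp [← Finset.mul_sum, ← ht, ht0.ne'])
  simp only [hf] at h1
  rw [conjDiag_smul, map_real_smul, ← Complex.coe_smul, det_smul] at h1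
  simp only [Pi.smul_apply, smul_eq_mul, Finset.prod_mul_distrib, Finset.prod_const,
    Finset.card_univ, Fintype.card_fin] at h1
  rw [← Complex.ofReal_pow, Complex.re_ofReal_mul, mul_div_mul_left _ _ (by positivity),
    div_le_div_iff₀ (Finset.prod_pos fun i _ => hl₀0 i) (Finset.prod_pos fun i _ => hl0 i)] at h1
  rw [det_conjDiag hU, det_conjDiag hU₀, Complex.ofReal_re, Complex.ofReal_re]
  exact h1

/-! ### First variation at a minimiser. -/

theorem exists_add_smul_one_posSemidef {H : Mat n} (hH : H.IsHermitian) :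
    ∃ b : ℝ, 0 < b ∧ (H + b • (1 : Mat n)).PosSemidef := by
  obtain ⟨U, hU, d, -, rfl⟩ := exists_conjDiag_antitone hH
  refine ⟨1 + ∑ i, |d i|, by positivity, ?_⟩
  rw [← conjDiag_one hU, ← conjDiag_smul, ← conjDiag_add]
  refine conjDiag_posSemidef U fun i => ?_
  have h1 := Finset.single_le_sum (fun j _ => abs_nonneg (d j)) (Finset.mem_univ i)
  have h2 := neg_abs_le (d i)
  simp only [Pi.add_apply, Pi.smul_apply, Pi.one_apply, smul_eq_mul, mul_one]
  linarith

theorem exists_sub_smul_one_posSemidef {X : Mat n} (hX : X.PosDef) :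
    ∃ c : ℝ, 0 < c ∧ (X - c • (1 : Mat n)).PosSemidef := by
  obtain ⟨U, hU, d, -, rfl⟩ := exists_conjDiag_antitone hX.isHermitian
  have hd := conjDiag_pos_of_posDef hU hX
  obtain ⟨c, hc, hcd⟩ : ∃ c : ℝ, 0 < c ∧ ∀ i, c ≤ d i := by
    obtain h | h := isEmpty_or_nonempty (Fin n)
    · exact ⟨1, one_pos, fun i => h.elim i⟩
    · obtain ⟨i, hi⟩ := Finite.exists_min d
      exact ⟨d i, hd i, hi⟩
  refine ⟨c, hc, ?_⟩
  rw [← conjDiag_one hU, ← conjDiag_smul, ← conjDiag_sub]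
  exact conjDiag_posSemidef U fun i => by simpa using hcd i

theorem exists_forall_add_smul_posDef {X H : Mat n} (hX : X.PosDef) (hH : H.IsHermitian) :
    ∃ η : ℝ, 0 < η ∧ ∀ s : ℝ, 0 ≤ s → s < η → (X + s • H).PosDef := by
  obtain ⟨b, hb, hHb⟩ := exists_add_smul_one_posSemidef hH
  obtain ⟨c, hc, hXc⟩ := exists_sub_smul_one_posSemidef hX
  refine ⟨c / b, by positivity, fun s hs hsη => ?_⟩
  rw [lt_div_iff₀ hb] at hsη
  have e : X + s • H = (c - s * b) • (1 : Mat n) + ((X - c • 1) + s • (H + b • 1)) := by module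
  rw [e]
  exact (PosDef.one.smul (sub_pos.2 hsη)).add_posSemidef (hXc.add (hHb.smul hs))

theorem IsPositiveMap.map_isHermitian (hpos : IsPositiveMap E) {H : Mat n}
    (hH : H.IsHermitian) : (E H).IsHermitian := by
  obtain ⟨b, hb, hHb⟩ := exists_add_smul_one_posSemidef hH
  have h1 := (hpos _ hHb).isHermitian.sub (hpos _ (PosSemidef.one.smul hb.le)).isHermitian
  rwa [← map_sub, add_sub_cancel_right] at h1

/-- Factor out `X` and expand `det (1 + s X⁻¹ H)` as a polynomial in `s`. -/
theorem det_add_smul_re {X : Mat n} (hX : X.PosDef) (H : Mat n) :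
    ∃ R : ℝ → ℝ, Continuous R ∧ ∀ s : ℝ,
      (X + s • H).det.re = X.det.re * (1 + s * (X⁻¹ * H).trace.re + s ^ 2 * R s) := by
  refine ⟨fun s => ((det (1 + (Polynomial.X : Polynomial ℂ) •
    (X⁻¹ * H).map Polynomial.C)).divX.divX.eval (s : ℂ)).re, by fun_prop, fun s => ?_⟩
  have hXu : IsUnit X.det := (isUnit_iff_isUnit_det X).1 hX.isUnit
  have e : X + s • H = X * (1 + (s : ℂ) • (X⁻¹ * H)) := by
    rw [Matrix.mul_add, Matrix.mul_smul, ← Matrix.mul_assoc, mul_nonsing_inv _ hXu,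
      Matrix.one_mul, Matrix.mul_one, Complex.coe_smul]
  have hre : X.det = ((X.det.re : ℝ) : ℂ) :=
    Complex.ext rfl (by simpa using (Complex.le_def.1 hX.det_pos.le).2.symm)
  rw [e, det_mul, hre, Complex.re_ofReal_mul, det_one_add_smul, Complex.ofReal_re,
    ← Complex.ofReal_pow, Complex.add_re, Complex.add_re, Complex.re_mul_ofReal,
    Complex.re_mul_ofReal, Complex.one_re]
  ring

/-- Compare the expansions at `X + s H` for small `s > 0`: the constant terms cancel; divide by `s`
and let `s → 0`. -/
theorem trace_inv_mul_re_le_of_minimizer {X H : Mat n} (hX : X.PosDef)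
    (hEX : (E X).PosDef) (hH : H.IsHermitian)
    (hmin : ∀ Z : Mat n, Z.PosDef → (E X).det.re * Z.det.re ≤ (E Z).det.re * X.det.re) :
    (X⁻¹ * H).trace.re ≤ ((E X)⁻¹ * E H).trace.re := by
  obtain ⟨R, hR, hXR⟩ := det_add_smul_re hX H
  obtain ⟨S, hS, hES⟩ := det_add_smul_re hEX (E H)
  obtain ⟨η, hη, hηX⟩ := exists_forall_add_smul_posDef hX hH
  have hx : 0 < X.det.re := (Complex.lt_def.1 hX.det_pos).1
  have hy : 0 < (E X).det.re := (Complex.lt_def.1 hEX.det_pos).1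
  have hlim : Filter.Tendsto (fun s : ℝ => ((E X)⁻¹ * E H).trace.re + s * (S s - R s))
      (nhdsWithin 0 (Set.Ioi 0)) (nhds ((E X)⁻¹ * E H).trace.re) := by
    have : Continuous fun s : ℝ => ((E X)⁻¹ * E H).trace.re + s * (S s - R s) := by fun_prop
    have h := this.tendsto 0
    simp only [zero_mul, add_zero] at h
    exact h.mono_left nhdsWithin_le_nhds
  refine ge_of_tendsto hlim ?_
  filter_upwards [Ioo_mem_nhdsGT hη] with s hs
  have h := hmin _ (hηX s hs.1.le hs.2)
  rw [map_add, map_real_smul, hXR, hES] at h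
  have h1 := mul_pos (mul_pos hy hx) hs.1
  refine le_of_mul_le_mul_left ?_ h1
  linarith

/-- The one-sided inequality at `H` and `-H` gives equality for Hermitian `H`; complex linearity
extends it to every `B`. -/
theorem trace_inv_mul_eq_of_minimizer (hpos : IsPositiveMap E) {X : Mat n} (hX : X.PosDef)
    (hEX : (E X).PosDef)
    (hmin : ∀ Z : Mat n, Z.PosDef → (E X).det.re * Z.det.re ≤ (E Z).det.re * X.det.re)
    (B : Mat n) : ((E X)⁻¹ * E B).trace = (X⁻¹ * B).trace := by
  have him : ∀ {P H : Mat n}, P.IsHermitian → H.IsHermitian → (P * H).trace.im = 0 := by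
    intro P H hP hH
    have h : star (P * H).trace = (P * H).trace := by
      rw [← trace_conjTranspose, conjTranspose_mul, hP.eq, hH.eq, trace_mul_comm]
    exact Complex.conj_eq_iff_im.1 h
  have hherm : ∀ H : Mat n, H.IsHermitian → ((E X)⁻¹ * E H).trace = (X⁻¹ * H).trace := by
    intro H hH
    refine Complex.ext (le_antisymm ?_ ?_) ?_
    · have h := trace_inv_mul_re_le_of_minimizer hX hEX hH.neg hmin
      simpa using h
    · exact trace_inv_mul_re_le_of_minimizer hX hEX hH hmin
    · rw [him hEX.inv.isHermitian (hpos.map_isHermitian hH), him hX.inv.isHermitian hH]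
  have h1 := hherm _ (isHermitian_add_transpose_self B)
  have h2 := hherm (Complex.I • (B - Bᴴ)) (by
    rw [IsHermitian, conjTranspose_smul, conjTranspose_sub, conjTranspose_conjTranspose,
      Complex.star_def, Complex.conj_I]
    module)
  rw [map_smul, Matrix.mul_smul, Matrix.mul_smul, trace_smul, trace_smul, smul_eq_mul,
    smul_eq_mul] at h2
  have h3 := mul_left_cancel₀ Complex.I_ne_zero h2
  simp only [map_add, map_sub, Matrix.mul_add, Matrix.mul_sub, trace_add, trace_sub] at h1 h3
  linear_combination (h1 + h3) / 2

/-! ### From a critical point to a scaling. -/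

theorem scaling_isPositiveMap (hpos : IsPositiveMap E) (X Y : Mat n) :
    IsPositiveMap (scaling E X Y) := fun _ hA =>
  (hpos _ (hA.mul_mul_conjTranspose_same X)).mul_mul_conjTranspose_same Y⁻¹

theorem hsAdjoint_one_of_tracePreserving (htr : IsTracePreserving E) : hsAdjoint E 1 = 1 := by
  ext i j
  simp only [hsAdjoint, LinearMap.coe_mk, AddHom.coe_mk, of_apply, Matrix.mul_one,
    trace_conjTranspose]
  rw [htr]
  obtain rfl | hij := eq_or_ne i j
  · simp [trace_single_eq_same]
  · simp [hij, trace_single_eq_of_ne]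

/-- A critical point of `det (E X) / det X` gives a doubly stochastic scaling of `E`. -/
theorem exists_doublyStochastic_scaling_of_critical (hpos : IsPositiveMap E) {X : Mat n}
    (hX : X.PosDef) (hEX : (E X).PosDef)
    (hcrit : ∀ B : Mat n, ((E X)⁻¹ * E B).trace = (X⁻¹ * B).trace) :
    ∃ P Q : Mat n, P.PosDef ∧ Q.PosDef ∧ IsDoublyStochastic (scaling E P Q) := by
  obtain ⟨P, hP, hPX⟩ := exists_posDef_sq hX
  obtain ⟨Q, hQ, hQX⟩ := exists_posDef_sq hEX
  have hPu : IsUnit P.det := (isUnit_iff_isUnit_det P).1 hP.isUnit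
  have hQu : IsUnit Q.det := (isUnit_iff_isUnit_det Q).1 hQ.isUnit
  have hQh : Q⁻¹ᴴ = Q⁻¹ := hQ.inv.isHermitian
  have hPh : Pᴴ = P := hP.isHermitian
  refine ⟨P, Q, hP, hQ, scaling_isPositiveMap hpos P Q, ?_, ?_⟩
  · change Q⁻¹ * E (P * 1 * Pᴴ) * Q⁻¹ᴴ = 1
    rw [hPh, hQh, Matrix.mul_one, hPX, ← hQX, ← Matrix.mul_assoc, nonsing_inv_mul _ hQu,
      Matrix.one_mul, mul_nonsing_inv _ hQu]
  · refine hsAdjoint_one_of_tracePreserving fun A => ?_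
    change (Q⁻¹ * E (P * A * Pᴴ) * Q⁻¹ᴴ).trace = A.trace
    rw [hPh, hQh, trace_mul_comm, ← Matrix.mul_assoc, ← Matrix.mul_inv_rev, hQX, hcrit, ← hPX,
      Matrix.mul_inv_rev, Matrix.mul_assoc P A P, Matrix.mul_assoc, ← Matrix.mul_assoc P⁻¹ P,
      nonsing_inv_mul _ hPu, Matrix.one_mul, trace_mul_comm, Matrix.mul_assoc,
      mul_nonsing_inv _ hPu, Matrix.mul_one]

theorem isDoublyStochastic_scaling_one (hpos : IsPositiveMap E) (htr : IsTracePreserving E)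
    (h1 : E 1 = 1) : IsDoublyStochastic (scaling E 1 1) := by
  refine ⟨scaling_isPositiveMap hpos 1 1, by simp [scaling, h1], ?_⟩
  exact hsAdjoint_one_of_tracePreserving fun A => by simp [scaling, htr A]

theorem eq_of_le_of_trace_eq {A B : Mat n} (h : A ≤ B) (htr : A.trace = B.trace) : B = A :=
  sub_eq_zero.1 ((le_iff.1 h).trace_eq_zero_iff.1 (by rw [trace_sub, htr, sub_self]))

end OperatorScaling

/-! ### Degenerate cases and conclusion. -/

theorem mainTheorem5 (n : ℕ)
    (E : OperatorScaling.Mat n →ₗ[ℂ] OperatorScaling.Mat n)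
    (hpos : OperatorScaling.IsPositiveMap E)
    (htr : OperatorScaling.IsTracePreserving E)
    (hE : ∃ ε : ℝ, 0 < ε ∧ (n : ℝ) * ε ≤ 1 ∧
      ∀ ρ : OperatorScaling.Mat n, ε • (1 : OperatorScaling.Mat n) ≤ ρ → ρ.trace = 1 →
        ((n : ℝ) * ε / (1 + ((n : ℝ) - 1) * n * ε)) • (1 : OperatorScaling.Mat n) ≤ E ρ) :
    ∃ X Y : OperatorScaling.Mat n, X.PosDef ∧ Y.PosDef ∧
      OperatorScaling.IsDoublyStochastic (OperatorScaling.scaling E X Y) := by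
  obtain ⟨ε, hε, hnε, hE⟩ := hE
  obtain _ | k := n
  · exact ⟨1, 1, .one, .one,
      OperatorScaling.isDoublyStochastic_scaling_one hpos htr (Subsingleton.elim _ _)⟩
  have hk : (1 : ℝ) ≤ ((k + 1 : ℕ) : ℝ) := by push_cast; linarith [k.cast_nonneg (α := ℝ)]
  have hden : 0 < 1 + (((k + 1 : ℕ) : ℝ) - 1) * (k + 1 : ℕ) * ε := by
    have : 0 ≤ (((k + 1 : ℕ) : ℝ) - 1) * (k + 1 : ℕ) * ε :=
      mul_nonneg (mul_nonneg (by linarith) (by linarith)) hε.le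
    linarith
  -- Exactly the cases where `δ = ε` and the gap is void. When `n ε = 1`, `E (ε 1) ≥ ε 1` with equal
  -- traces, which forces equality.
  by_cases hk1 : k = 0 ∨ ((k + 1 : ℕ) : ℝ) * ε = 1
  · refine ⟨1, 1, .one, .one, OperatorScaling.isDoublyStochastic_scaling_one hpos htr ?_⟩
    obtain rfl | h1 := hk1
    · have h := htr 1
      ext i j
      obtain rfl : i = 0 := Fin.fin_one_eq_zero i
      obtain rfl : j = 0 := Fin.fin_one_eq_zero j
      simpa [Matrix.trace] using h
    · have hδ : ((k + 1 : ℕ) : ℝ) * ε / (1 + (((k + 1 : ℕ) : ℝ) - 1) * (k + 1 : ℕ) * ε) = ε := by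
        rw [mul_assoc, h1, mul_one, add_sub_cancel]
        exact (eq_div_of_mul_eq (by positivity) ((mul_comm _ _).trans h1)).symm
      have h := hE (ε • 1) le_rfl (by
        rw [Matrix.trace_smul, Matrix.trace_one, Fintype.card_fin, Complex.real_smul, mul_comm]
        exact_mod_cast h1)
      rw [hδ, OperatorScaling.map_real_smul] at h
      have h2 := OperatorScaling.eq_of_le_of_trace_eq h
        (by rw [Matrix.trace_smul, Matrix.trace_smul, htr])
      exact smul_right_injective _ hε.ne' h2
  · obtain ⟨hk0, h1⟩ := not_or.1 hk1
    have hlt : ((k + 1 : ℕ) : ℝ) * ε < 1 := lt_of_le_of_ne hnε h1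
    have hk' : (0 : ℝ) < k := by exact_mod_cast Nat.pos_of_ne_zero hk0
    have hεδ : ε < ((k + 1 : ℕ) : ℝ) * ε / (1 + (((k + 1 : ℕ) : ℝ) - 1) * (k + 1 : ℕ) * ε) := by
      rw [lt_div_iff₀ hden, mul_comm]
      refine mul_lt_mul_of_pos_right ?_ hε
      rw [mul_assoc]
      have : (((k + 1 : ℕ) : ℝ) - 1) = k := by push_cast; ring
      nlinarith
    obtain ⟨X, hX, hEX, hmin⟩ :=
      OperatorScaling.exists_det_ratio_minimizer hpos htr hε hnε hεδ hE
    exact OperatorScaling.exists_doublyStochastic_scaling_of_critical hpos hX hEX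
      (OperatorScaling.trace_inv_mul_eq_of_minimizer hpos hX hEX hmin)
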